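/- Let $C$ and $D$ be small categories, let $K$ be a Grothendieck topology on $D$, and let $f\colon C\to D$ be a functor. A small family of morphisms with common target in a site is called a covering family if the sieve it generates is covering. The functor $f$ is called covering-flat (with respect to $K$) if for every finite diagram $g\colon E\to C$ and every cone $T$ over $f\circ g$ in $D$, with vertex $u$, there are a small family $(S_s)_s$ of cones over $g$ in $C$ and a covering family $(p_i\colon v_i\to u)_i$ in $D$ such that for each $i$ the cone $T\circ p_i$ factors, by some morphism from $v_i$ to the vertex of $f(S_s)$, through the image cone $f(S_s)$ for some $s$. If $J$ is a Grothendieck topology on $C$, then $f$ is called a morphism of sites $(C,J)\to(D,K)$ if it is covering-flat and sends covering families for $J$ to covering families for $K$. (1) The functor $f$ is covering-flat if and only if the composite $$[C^{\mathrm{op}},\mathbf{Set}]\xrightarrow{\ \mathrm{Lan}_f\ }[D^{\mathrm{op}},\mathbf{Set}]\xrightarrow{\ a\ }\mathrm{Sh}(D,K)$$ preserves finite limits, where $\mathrm{Lan}_f$ is left Kan extension along $f^{\mathrm{op}}$ and $a$ is sheafification. (2) If $J$ is a Grothendieck topology on $C$ for which $f$ is a morphism of sites $(C,J)\to(D,K)$,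 then restriction $f^*\colon [D^{\mathrm{op}},\mathbf{Set}]\to[C^{\mathrm{op}},\mathbf{Set}]$, $P\mapsto P\circ f^{\mathrm{op}}$, takes $\mathrm{Sh}(D,K)$ into $\mathrm{Sh}(C,J)$, and the resulting functor $\mathrm{Sh}(D,K)\to\mathrm{Sh}(C,J)$ is the direct image of a geometric morphism, that is, it has a left adjoint that preserves finite limits. -/

import Mathlib

open CategoryTheory CategoryTheory.Limits

universe u

namespace Sites

section Arrays

variable {C : Type u} [SmallCategory.{u} C] {D : Type u} [SmallCategory.{u} D]

/-- A small family of morphisms `p i : V i ⟶ U` is a covering family for the Grothendieck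
topology `K` if the sieve that it generates is a covering sieve. -/
def IsCoveringFamily (K : GrothendieckTopology D) {U : D} {ι : Type u} (V : ι → D)
    (p : ∀ i, V i ⟶ U) : Prop :=
  Sieve.ofArrows V p ∈ K U

/-- The cone `T` over `G ⋙ F` factors locally through the `F`-image of the array `S` over `G`
(an array over `G` is a small family of cones over `G`): there is a covering family `p` of the
vertex of `T` such that each `p i ≫ T` factors through the `F`-image of some cone in `S`. -/
def FactorsLocally (K : GrothendieckTopology D) (F : C ⥤ D) {E : Type} [SmallCategory E]
    (G : E ⥤ C) (T : Cone (G ⋙ F)) {σ : Type u} (S : σ → Cone G) : Prop :=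
  ∃ (ι : Type u) (V : ι → D) (p : ∀ i, V i ⟶ T.pt), IsCoveringFamily K V p ∧
    ∀ i : ι, ∃ (s : σ) (h : V i ⟶ F.obj (S s).pt),
      ∀ e : E, p i ≫ T.π.app e = h ≫ F.map ((S s).π.app e)

/-- `F : C ⥤ D` is covering-flat for the topology `K` on `D` if, for every finite diagram `G`
in `C`, every cone over `G ⋙ F` factors locally through the `F`-image of some array over `G`. -/
def IsCoveringFlat (K : GrothendieckTopology D) (F : C ⥤ D) : Prop :=
  ∀ (E : Type) [SmallCategory E] [FinCategory E] (G : E ⥤ C) (T : Cone (G ⋙ F)),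
    ∃ (σ : Type u) (S : σ → Cone G), FactorsLocally K F G T S

/-- A morphism of sites is a covering-flat functor that preserves covering families. -/
structure IsMorphismOfSites (J : GrothendieckTopology C) (K : GrothendieckTopology D)
    (F : C ⥤ D) : Prop where
  isCoveringFlat : IsCoveringFlat K F
  map_isCoveringFamily : ∀ {U : C} {ι : Type u} (V : ι → C) (p : ∀ i, V i ⟶ U),
    IsCoveringFamily J V p → IsCoveringFamily K (fun i => F.obj (V i)) (fun i => F.map (p i))

/-- If restriction along `F` takes sheaves to sheaves, it is a functor between the categories
of sheaves. -/
def restrictSheaves (J : GrothendieckTopology C) (K : GrothendieckTopology D) (F : C ⥤ D)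
    (h : ∀ P : Dᵒᵖ ⥤ Type u, Presheaf.IsSheaf K P → Presheaf.IsSheaf J (F.op ⋙ P)) :
    Sheaf K (Type u) ⥤ Sheaf J (Type u) where
  obj P := ⟨F.op ⋙ P.obj, h P.obj P.property⟩
  map φ := ⟨Functor.whiskerLeft F.op φ.hom⟩

end Arrays

/-- A geometric morphism `X → Y`: a direct image functor `X ⥤ Y` with a left adjoint, the inverse
image functor, that preserves finite limits. -/
structure GeometricMorphism (X : Type*) [Category* X] (Y : Type*) [Category* Y] where
  directImage : X ⥤ Y
  inverseImage : Y ⥤ X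
  adjunction : inverseImage ⊣ directImage
  preservesFiniteLimits : PreservesFiniteLimits inverseImage

end Sites

open Opposite

namespace Sites

/-! ### Covering-flatness in terms of sieves, and its basic instances. -/

section Covers

variable {C : Type u} [SmallCategory.{u} C] {D : Type u} [SmallCategory.{u} D]
  {K : GrothendieckTopology D} {F : C ⥤ D}

/-! An element of `Lan_F P` at `v` is a class of pairs `(h : v ⟶ F x, p ∈ P x)`. If `F` is
covering-flat, finite products, equalizers and pullbacks of generalized elements can be imitated
locally by objects of `C`, so equal classes locally have a common refinement, as in a filtered
colimit. Hence for finite `H` the comparison `Lan (lim H) ⟶ lim (Lan H)` is locally injective and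
locally surjective, and sheafification inverts it.

Conversely, apply preservation to `H = G ⋙ yoneda`: a cone `T` over `G ⋙ F` is an element of `lim
(Lan H)`, and an element of `lim H` at `x` is a cone over `G` with vertex `x`. Local surjectivity of
the comparison is then the required local factorization.

For a morphism of sites, flatness carries compatible families to compatible families, so restriction
preserves sheaves; its left adjoint is sheafified `Lan_F` on sheaves, left exact by the first part.
-/

/-- The sieve of all morphisms `f` such that `f ≫ T` factors through the `F`-image of some
cone over `G`. -/
def coneSieve (F : C ⥤ D) {E : Type} [SmallCategory E] (G : E ⥤ C) (T : Cone (G ⋙ F)) :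
    Sieve T.pt where
  arrows w f := ∃ (S : Cone G) (h : w ⟶ F.obj S.pt),
    ∀ e : E, f ≫ T.π.app e = h ≫ F.map (S.π.app e)
  downward_closed := by
    rintro w w' f ⟨S, h, H⟩ k
    exact ⟨S, k ≫ h, fun e => by simp [H]⟩

/-- As `C` is small, all cones over `G` form one array, which serves every `T`. -/
lemma isCoveringFlat_iff_coneSieve_mem :
    IsCoveringFlat K F ↔ ∀ (E : Type) [SmallCategory E] [FinCategory E] (G : E ⥤ C)
      (T : Cone (G ⋙ F)), coneSieve F G T ∈ K T.pt := by
  constructor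
  · intro H E _ _ G T
    obtain ⟨σ, S, ι, V, p, hp, hS⟩ := H E G T
    refine K.superset_covering ?_ hp
    rw [Sieve.ofArrows, Sieve.generate_le_iff]
    rintro _ _ ⟨i⟩
    obtain ⟨s, h, hs⟩ := hS i
    exact ⟨S s, h, hs⟩
  · intro H E _ _ G T
    obtain ⟨ι, V, p, hp⟩ := (coneSieve F G T).exists_eq_ofArrows
    refine ⟨Cone G, id, ι, V, p, ?_, fun i => ?_⟩
    · rw [IsCoveringFamily, ← hp]
      exact H E G T
    · have : coneSieve F G T (p i) := by
        rw [hp]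
        exact Sieve.ofArrows_mk V p i
      exact this

/-- A functor that is covering-flat covers every finite family of generalized elements by
generalized elements of a single object. -/
lemma IsCoveringFlat.exists_common_source (hF : IsCoveringFlat K F) {ι : Type} [Finite ι]
    {v : D} {x : ι → C} (h : ∀ i, v ⟶ F.obj (x i)) :
    ∃ R ∈ K v, ∀ ⦃w : D⦄ (f : w ⟶ v), R f →
      ∃ (z : C) (k : w ⟶ F.obj z) (g : ∀ i, z ⟶ x i), ∀ i, f ≫ h i = k ≫ F.map (g i) := by
  classical
  have := Fintype.ofFinite ι
  let T : Cone (Discrete.functor x ⋙ F) :=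
    { pt := v, π := Discrete.natTrans fun i => h i.as }
  refine ⟨_, isCoveringFlat_iff_coneSieve_mem.1 hF _ _ T, ?_⟩
  rintro w f ⟨S, k, H⟩
  exact ⟨S.pt, k, fun i => S.π.app ⟨i⟩, fun i => H ⟨i⟩⟩

lemma IsCoveringFlat.exists_equalizing (hF : IsCoveringFlat K F) {v : D} {x y : C}
    (h : v ⟶ F.obj x) (a b : x ⟶ y) (hab : h ≫ F.map a = h ≫ F.map b) :
    ∃ R ∈ K v, ∀ ⦃w : D⦄ (f : w ⟶ v), R f →
      ∃ (z : C) (k : w ⟶ F.obj z) (g : z ⟶ x), f ≫ h = k ≫ F.map g ∧ g ≫ a = g ≫ b := by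
  let T : Cone (parallelPair a b ⋙ F) :=
    { pt := v
      π :=
        { app := fun j => match j with
            | .zero => h
            | .one => h ≫ F.map a
          naturality := by
            rintro _ _ (_ | _ | _)
            · simp
            · simp [hab]
            · simp } }
  refine ⟨_, isCoveringFlat_iff_coneSieve_mem.1 hF _ _ T, ?_⟩
  rintro w f ⟨S, k, H⟩
  refine ⟨S.pt, k, S.π.app .zero, H .zero, ?_⟩
  have h₁ := S.w WalkingParallelPairHom.left
  have h₂ := S.w WalkingParallelPairHom.right
  exact h₁.trans h₂.symm

lemma IsCoveringFlat.exists_commSq (hF : IsCoveringFlat K F) {v : D} {x y c : C}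
    (h : v ⟶ F.obj x) (h' : v ⟶ F.obj y) (a : x ⟶ c) (b : y ⟶ c)
    (hab : h ≫ F.map a = h' ≫ F.map b) :
    ∃ R ∈ K v, ∀ ⦃w : D⦄ (f : w ⟶ v), R f →
      ∃ (z : C) (k : w ⟶ F.obj z) (g : z ⟶ x) (g' : z ⟶ y),
        f ≫ h = k ≫ F.map g ∧ f ≫ h' = k ≫ F.map g' ∧ g ≫ a = g' ≫ b := by
  let T : Cone (cospan a b ⋙ F) :=
    { pt := v
      π :=
        { app := fun j => match j with
            | .one => h ≫ F.map a
            | .left => h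
            | .right => h'
          naturality := by
            rintro _ _ (_ | (_ | _))
            · simp
            · simp
            · simp [hab] } }
  refine ⟨_, isCoveringFlat_iff_coneSieve_mem.1 hF _ _ T, ?_⟩
  rintro w f ⟨S, k, H⟩
  refine ⟨S.pt, k, S.π.app .left, S.π.app .right, H .left, H .right, ?_⟩
  have h₁ := S.w WalkingCospan.Hom.inl
  have h₂ := S.w WalkingCospan.Hom.inr
  exact h₁.trans h₂.symm

end Covers

/-! ### Elements of the left Kan extension. -/

section LeftKanExtension

variable {C : Type u} [SmallCategory.{u} C] {D : Type u} [SmallCategory.{u} D]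
  {K : GrothendieckTopology D} {F : C ⥤ D} {P Q : Cᵒᵖ ⥤ Type u}

/-- The element of the left Kan extension of `P` along `F.op` represented by `p`. -/
noncomputable def lanMk {v : D} {x : C} (h : v ⟶ F.obj x) (p : P.obj (op x)) :
    (F.op.lan.obj P).obj (op v) :=
  (F.op.lan.obj P).map h.op ((F.op.lanUnit.app P).app (op x) p)

lemma lan_obj_map_lanMk {v w : D} {x : C} (f : w ⟶ v) (h : v ⟶ F.obj x) (p : P.obj (op x)) :
    (F.op.lan.obj P).map f.op (lanMk h p) = lanMk (f ≫ h) p := by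
  simp [lanMk]

lemma lanMk_comp_map {v : D} {x y : C} (h : v ⟶ F.obj y) (g : y ⟶ x) (p : P.obj (op x)) :
    lanMk (h ≫ F.map g) p = lanMk h (P.map g.op p) := by
  simp [lanMk]

lemma lan_map_app_lanMk (α : P ⟶ Q) {v : D} {x : C} (h : v ⟶ F.obj x) (p : P.obj (op x)) :
    (F.op.lan.map α).app (op v) (lanMk h p) = lanMk h (α.app (op x) p) := by
  have h₁ := NatTrans.naturality_apply (F.op.lan.map α) h.op ((F.op.lanUnit.app P).app (op x) p)
  have h₂ := congr_app (F.op.lanUnit.naturality α) (op x)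
  have h₃ := ConcreteCategory.congr_hom h₂ p
  simp only [lanMk]
  refine h₁.trans (congrArg _ h₃.symm)

lemma exists_lanMk_eq {v : D} (t : (F.op.lan.obj P).obj (op v)) :
    ∃ (x : C) (h : v ⟶ F.obj x) (p : P.obj (op x)), lanMk h p = t := by
  obtain ⟨j, p, hp⟩ := Types.jointly_surjective_of_isColimit
    (Functor.isPointwiseLeftKanExtensionLeftKanExtensionUnit F.op P (op v)) t
  exact ⟨j.left.unop, j.hom.unop, p, hp⟩

/-- By the pointwise formula the value at `v` is a colimit of sets, hence a quotient by the
generated equivalence relation. -/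
lemma eqvGen_of_lanMk_eq {v : D} {x y : C} {h : v ⟶ F.obj x} {p : P.obj (op x)}
    {k : v ⟶ F.obj y} {q : P.obj (op y)} (e : lanMk h p = lanMk k q) :
    Relation.EqvGen (CostructuredArrow.proj F.op (op v) ⋙ P).ColimitTypeRel
      ⟨CostructuredArrow.mk (Y := op x) h.op, p⟩ ⟨CostructuredArrow.mk (Y := op y) k.op, q⟩ := by
  have hc := (Types.isColimit_iff_coconeTypesIsColimit _).1
    ⟨Functor.isPointwiseLeftKanExtensionLeftKanExtensionUnit F.op P (op v)⟩
  apply Quot.eq.1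
  apply hc.bijective.1
  exact e

end LeftKanExtension

/-! ### Local refinement of equal representatives. -/

section LocalEquality

variable {C : Type u} [SmallCategory.{u} C] {D : Type u} [SmallCategory.{u} D]
  {K : GrothendieckTopology D} {F : C ⥤ D}

/-- The sieve of all morphisms along which the representatives `(h, p)` and `(h', p')` of
elements of the left Kan extension of `P` become equal to a common refinement. -/
def refinementSieve (P : Cᵒᵖ ⥤ Type u) {v : D} {x x' : C} (h : v ⟶ F.obj x) (p : P.obj (op x))
    (h' : v ⟶ F.obj x') (p' : P.obj (op x')) : Sieve v where
  arrows w f := ∃ (z : C) (k : w ⟶ F.obj z) (g : z ⟶ x) (g' : z ⟶ x'),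
    f ≫ h = k ≫ F.map g ∧ f ≫ h' = k ≫ F.map g' ∧ P.map g.op p = P.map g'.op p'
  downward_closed := by
    rintro w w' f ⟨z, k, g, g', e₁, e₂, e₃⟩ l
    exact ⟨z, l ≫ k, g, g', by simp [e₁], by simp [e₂], e₃⟩

/-- The sieve of all morphisms along which `h` factors through the `F`-image of a morphism
equalizing all pairs `p i`, `q i`. -/
def equalizingSieve {ι : Type} (P : ι → Cᵒᵖ ⥤ Type u) (s : Set ι) {v : D} {x : C}
    (h : v ⟶ F.obj x) (p q : ∀ i, (P i).obj (op x)) : Sieve v where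
  arrows w f := ∃ (z : C) (k : w ⟶ F.obj z) (g : z ⟶ x),
    f ≫ h = k ≫ F.map g ∧ ∀ i ∈ s, (P i).map g.op (p i) = (P i).map g.op (q i)
  downward_closed := by
    rintro w w' f ⟨z, k, g, e₁, e₂⟩ l
    exact ⟨z, l ≫ k, g, by simp [e₁], e₂⟩

/-- The two refinements form a cospan over `x₂` whose legs agree on `w`; locally it is completed to
a commutative square in `C`. -/
lemma IsCoveringFlat.refinementSieve_trans (hF : IsCoveringFlat K F) {P : Cᵒᵖ ⥤ Type u} {v : D}
    {x₁ x₂ x₃ : C} {h₁ : v ⟶ F.obj x₁} {p₁ : P.obj (op x₁)} {h₂ : v ⟶ F.obj x₂}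
    {p₂ : P.obj (op x₂)} {h₃ : v ⟶ F.obj x₃} {p₃ : P.obj (op x₃)}
    (h₁₂ : refinementSieve P h₁ p₁ h₂ p₂ ∈ K v) (h₂₃ : refinementSieve P h₂ p₂ h₃ p₃ ∈ K v) :
    refinementSieve P h₁ p₁ h₃ p₃ ∈ K v := by
  refine K.transitive (K.intersection_covering h₁₂ h₂₃) _ ?_
  rintro w f ⟨⟨z, k, g, g', e₁, e₂, e⟩, ⟨z', k', l, l', e₁', e₂', e'⟩⟩
  obtain ⟨R, hR, H⟩ := hF.exists_commSq k k' g' l (by rw [← e₂, e₁'])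
  refine K.superset_covering ?_ hR
  intro w' f' hf'
  obtain ⟨y, m, a, b, ha, hb, hab⟩ := H f' hf'
  refine ⟨y, m, a ≫ g, b ≫ l', ?_, ?_, ?_⟩
  · simp [e₁, reassoc_of% ha]
  · simp [e₂', reassoc_of% hb]
  · have h₁ : P.map (a ≫ g').op p₂ = P.map (b ≫ l).op p₂ := by rw [hab]
    simp only [op_comp, Functor.map_comp_apply] at h₁ ⊢
    rw [e, h₁, e']

lemma refinementSieve_self_mem (P : Cᵒᵖ ⥤ Type u) {v : D} {x : C} (h : v ⟶ F.obj x)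
    (p : P.obj (op x)) : refinementSieve P h p h p ∈ K v :=
  K.superset_covering (fun w f _ => ⟨x, f ≫ h, 𝟙 x, 𝟙 x, by simp, by simp, rfl⟩) (K.top_mem v)

lemma refinementSieve_symm_mem {P : Cᵒᵖ ⥤ Type u} {v : D} {x x' : C} {h : v ⟶ F.obj x}
    {p : P.obj (op x)} {h' : v ⟶ F.obj x'} {p' : P.obj (op x')}
    (H : refinementSieve P h p h' p' ∈ K v) : refinementSieve P h' p' h p ∈ K v := by
  refine K.superset_covering ?_ H
  rintro w f ⟨z, k, g, g', e₁, e₂, e₃⟩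
  exact ⟨z, k, g', g, e₂, e₁, e₃.symm⟩

/-- If `F` is covering-flat, representatives of the same element of the left Kan extension
locally have a common refinement. -/
lemma IsCoveringFlat.refinementSieve_mem (hF : IsCoveringFlat K F) {P : Cᵒᵖ ⥤ Type u} {v : D}
    {x x' : C} {h : v ⟶ F.obj x} {p : P.obj (op x)} {h' : v ⟶ F.obj x'} {p' : P.obj (op x')}
    (e : lanMk h p = lanMk h' p') : refinementSieve P h p h' p' ∈ K v := by
  suffices H : ∀ a b, Relation.EqvGen
      (CostructuredArrow.proj F.op (op v) ⋙ P).ColimitTypeRel a b →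
      refinementSieve (F := F) P (x := a.1.left.unop) a.1.hom.unop a.2
        (x' := b.1.left.unop) b.1.hom.unop b.2 ∈ K v from
    H _ _ (eqvGen_of_lanMk_eq e)
  intro a b hab
  induction hab with
  | rel a b hab =>
    obtain ⟨f, hf⟩ := hab
    refine K.superset_covering (fun w g _ => ?_) (K.top_mem v)
    have hw := congrArg Quiver.Hom.unop (CostructuredArrow.w f)
    refine ⟨b.1.left.unop, g ≫ b.1.hom.unop, f.left.unop, 𝟙 _, ?_, by simp, ?_⟩
    · rw [← hw]
      simp
    · rw [hf]
      exact (Functor.map_id_apply P _ _).symm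
  | refl a => exact refinementSieve_self_mem _ _ _
  | symm a b _ ih => exact refinementSieve_symm_mem ih
  | trans a b c _ _ ih₁ ih₂ => exact hF.refinementSieve_trans ih₁ ih₂

/-- A common refinement may use distinct maps `g`, `g'` to `x`; they agree on `w`, so they are
locally equalized in `C`. -/
lemma IsCoveringFlat.exists_map_eq (hF : IsCoveringFlat K F) {P : Cᵒᵖ ⥤ Type u} {v : D}
    {x : C} {h : v ⟶ F.obj x} {p q : P.obj (op x)} (e : lanMk h p = lanMk h q) :
    ∃ R ∈ K v, ∀ ⦃w : D⦄ (f : w ⟶ v), R f → ∃ (z : C) (k : w ⟶ F.obj z) (g : z ⟶ x),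
      f ≫ h = k ≫ F.map g ∧ P.map g.op p = P.map g.op q := by
  let S : Sieve v :=
    { arrows w f := ∃ (z : C) (k : w ⟶ F.obj z) (g : z ⟶ x),
        f ≫ h = k ≫ F.map g ∧ P.map g.op p = P.map g.op q
      downward_closed := by
        rintro w w' f ⟨z, k, g, e₁, e₂⟩ l
        exact ⟨z, l ≫ k, g, by simp [e₁], e₂⟩ }
  refine ⟨S, K.transitive (hF.refinementSieve_mem e) _ ?_, fun _ _ h => h⟩
  rintro w f ⟨z, k, g, g', e₁, e₂, e₃⟩
  obtain ⟨R, hR, H⟩ := hF.exists_equalizing k g g' (by rw [← e₁, e₂])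
  refine K.superset_covering ?_ hR
  intro w' f' hf'
  obtain ⟨y, m, a, hm, ha⟩ := H f' hf'
  refine ⟨y, m, a ≫ g, ?_, ?_⟩
  · simp [e₁, reassoc_of% hm]
  · have h₁ : P.map (a ≫ g).op q = P.map (a ≫ g').op q := by rw [ha]
    rw [h₁]
    simp only [op_comp, Functor.map_comp_apply]
    rw [e₃]

lemma IsCoveringFlat.equalizingSieve_mem (hF : IsCoveringFlat K F) {ι : Type} [Finite ι]
    (P : ι → Cᵒᵖ ⥤ Type u) {v : D} {x : C} (h : v ⟶ F.obj x) (p q : ∀ i, (P i).obj (op x))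
    (e : ∀ i, lanMk h (p i) = lanMk h (q i)) :
    equalizingSieve P Set.univ h p q ∈ K v := by
  refine Set.Finite.induction_on (motive := fun s _ => equalizingSieve P s h p q ∈ K v) _
    Set.finite_univ ?_ ?_
  · exact K.superset_covering (fun w f _ => ⟨x, f ≫ h, 𝟙 x, by simp, by simp⟩) (K.top_mem v)
  · intro i s _ _ hs
    refine K.transitive hs _ ?_
    rintro w f ⟨z, k, g, e₁, e₂⟩
    obtain ⟨R, hR, H⟩ := hF.exists_map_eq (h := k) (p := (P i).map g.op (p i))
      (q := (P i).map g.op (q i)) (by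
        rw [← lanMk_comp_map, ← lanMk_comp_map, ← e₁, ← lan_obj_map_lanMk, e i,
          lan_obj_map_lanMk])
    refine K.superset_covering ?_ hR
    intro w' f' hf'
    obtain ⟨y, m, a, hm, ha⟩ := H f' hf'
    refine ⟨y, m, a ≫ g, by simp [e₁, reassoc_of% hm], ?_⟩
    rintro j (rfl | hj)
    · simpa using ha
    · simp [e₂ j hj]

end LocalEquality

/-! ### Limits of presheaves, elementwise. -/

section LimitsOfPresheaves

variable {D : Type u} [SmallCategory.{u} D] {E : Type} [SmallCategory E]
  {H : E ⥤ Dᵒᵖ ⥤ Type u} {c : Cone H}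

lemma cone_π_app_map_apply (c : Cone H) (e : E) {U V : Dᵒᵖ} (f : U ⟶ V) (s : c.pt.obj U) :
    (c.π.app e).app V (c.pt.map f s) = (H.obj e).map f ((c.π.app e).app U s) :=
  NatTrans.naturality_apply (c.π.app e) f s

lemma isLimit_presheaf_ext (hc : IsLimit c) {U : Dᵒᵖ} {s t : c.pt.obj U}
    (h : ∀ e, (c.π.app e).app U s = (c.π.app e).app U t) : s = t := by
  have hc' := isLimitOfPreserves ((evaluation Dᵒᵖ (Type u)).obj U) hc
  exact Concrete.isLimit_ext _ hc' _ _ h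

lemma isLimit_presheaf_exists (hc : IsLimit c) {U : Dᵒᵖ} (t : ∀ e, (H.obj e).obj U)
    (ht : ∀ ⦃e e' : E⦄ (α : e ⟶ e'), (H.map α).app U (t e) = t e') :
    ∃ s : c.pt.obj U, ∀ e, (c.π.app e).app U s = t e := by
  have hc' := isLimitOfPreserves ((evaluation Dᵒᵖ (Type u)).obj U) hc
  refine ⟨(Types.isLimitEquivSections hc').symm ⟨t, fun α => ht α⟩, fun e => ?_⟩
  exact Types.isLimitEquivSections_symm_apply hc' ⟨t, fun α => ht α⟩ e

end LimitsOfPresheaves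

/-! ### Covering-flatness and preservation of finite limits. -/

section FiniteLimits

variable {C : Type u} [SmallCategory.{u} C] {D : Type u} [SmallCategory.{u} D]
  {K : GrothendieckTopology D} {F : C ⥤ D} {E : Type} [SmallCategory E]
  {H : E ⥤ Cᵒᵖ ⥤ Type u} {c : Cone H} {d : Cone (H ⋙ F.op.lan)}

lemma isLimit_lift_lan_app_lanMk (hd : IsLimit d) (e : E) {v : D} {x : C} (h : v ⟶ F.obj x)
    (p : c.pt.obj (op x)) :
    (d.π.app e).app (op v) ((hd.lift (F.op.lan.mapCone c)).app (op v) (lanMk h p)) =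
      lanMk h ((c.π.app e).app (op x) p) := by
  have h₁ := congr_app (hd.fac (F.op.lan.mapCone c) e) (op v)
  exact (ConcreteCategory.congr_hom h₁ (lanMk h p)).trans (lan_map_app_lanMk _ _ _)

lemma IsCoveringFlat.isLocallyInjective_lift [Finite E] (hF : IsCoveringFlat K F)
    (hc : IsLimit c) (hd : IsLimit d) :
    Presheaf.IsLocallyInjective K (hd.lift (F.op.lan.mapCone c)) where
  equalizerSieve_mem {U} s t hst := by
    induction U using Opposite.rec with | _ v
    obtain ⟨x, h, p, rfl⟩ := exists_lanMk_eq s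
    obtain ⟨y, k, q, rfl⟩ := exists_lanMk_eq t
    obtain ⟨R, hR, HR⟩ := hF.exists_common_source
      (x := fun b : Bool => cond b x y) (fun b => match b with | true => h | false => k)
    refine K.transitive hR _ ?_
    intro w f hf
    obtain ⟨z, m, a, b, hx, hy⟩ : ∃ (z : C) (m : w ⟶ F.obj z) (a : z ⟶ x) (b : z ⟶ y),
        f ≫ h = m ≫ F.map a ∧ f ≫ k = m ≫ F.map b := by
      obtain ⟨z, m, g, hg⟩ := HR f hf
      exact ⟨z, m, g true, g false, hg true, hg false⟩
    -- Over the common source `z`, equality in the limit amounts to finitely many equalities, one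
    -- for each object of `E`.
    refine K.superset_covering ?_ (hF.equalizingSieve_mem H.obj m
      (fun e => (c.π.app e).app _ (c.pt.map a.op p))
      (fun e => (c.π.app e).app _ (c.pt.map b.op q)) ?_)
    · rintro w' f' ⟨z', m', g', e₁, e₂⟩
      have e₃ : c.pt.map g'.op (c.pt.map a.op p) =
          c.pt.map g'.op (c.pt.map b.op q) :=
        isLimit_presheaf_ext hc fun e => by
          exact (cone_π_app_map_apply c e _ _).trans
            ((e₂ e trivial).trans (cone_π_app_map_apply c e _ _).symm)
      change (F.op.lan.obj c.pt).map (f' ≫ f).op _ = (F.op.lan.obj c.pt).map (f' ≫ f).op _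
      rw [lan_obj_map_lanMk, lan_obj_map_lanMk, Category.assoc, Category.assoc, hx, hy,
        ← Category.assoc, ← Category.assoc, lanMk_comp_map, lanMk_comp_map, e₁, lanMk_comp_map,
        lanMk_comp_map, e₃]
    · intro e
      have e₁ := congrArg ((F.op.lan.obj (H.obj e)).map f.op)
        (congrArg ((d.π.app e).app (op v)) hst)
      rw [isLimit_lift_lan_app_lanMk, isLimit_lift_lan_app_lanMk] at e₁
      refine Eq.trans ?_ (e₁.trans ?_)
      · rw [lan_obj_map_lanMk, hx, lanMk_comp_map, cone_π_app_map_apply]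
      · rw [lan_obj_map_lanMk, hy, lanMk_comp_map, cone_π_app_map_apply]

lemma IsCoveringFlat.isLocallySurjective_lift [FinCategory E] (hF : IsCoveringFlat K F)
    (hc : IsLimit c) (hd : IsLimit d) :
    Presheaf.IsLocallySurjective K (hd.lift (F.op.lan.mapCone c)) where
  imageSieve_mem {v} s := by
    have hs (e : E) := exists_lanMk_eq ((d.π.app e).app (op v) s)
    choose x h p hp using hs
    obtain ⟨R, hR, HR⟩ := hF.exists_common_source h
    refine K.transitive hR _ ?_
    intro w f hf
    obtain ⟨z, m, g, hg⟩ := HR f hf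
    have hm (e : E) : lanMk m ((H.obj e).map (g e).op (p e)) =
        (F.op.lan.obj (H.obj e)).map f.op ((d.π.app e).app (op v) s) := by
      rw [← hp, lan_obj_map_lanMk, hg, lanMk_comp_map]
    -- The components, now all over `z`, are compatible only as classes; equalizing once for each of
    -- the finitely many arrows of `E` makes them an element of the limit.
    refine K.superset_covering ?_ (hF.equalizingSieve_mem
      (fun α : (Σ e : E, Σ e' : E, (e ⟶ e')) => H.obj α.2.1) m
      (fun α => (H.map α.2.2).app _ ((H.obj α.1).map (g α.1).op (p α.1)))
      (fun α => (H.obj α.2.1).map (g α.2.1).op (p α.2.1)) ?_)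
    · rintro w' f' ⟨z', m', g', e₁, e₂⟩
      obtain ⟨r, hr⟩ := isLimit_presheaf_exists hc
        (fun e => (H.obj e).map g'.op ((H.obj e).map (g e).op (p e))) (fun e e' α => by
          rw [NatTrans.naturality_apply]
          exact e₂ ⟨e, e', α⟩ trivial)
      refine ⟨lanMk m' r, isLimit_presheaf_ext hd fun e => ?_⟩
      rw [isLimit_lift_lan_app_lanMk, hr, ← lanMk_comp_map, ← e₁, ← lan_obj_map_lanMk, hm, cone_π_app_map_apply]
      simp
    · rintro ⟨e, e', α⟩
      rw [hm, ← lan_map_app_lanMk, hm]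
      have h₁ := congr_app (d.w α) (op v)
      have h₂ := ConcreteCategory.congr_hom h₁ s
      rw [← h₂]
      exact NatTrans.naturality_apply (F.op.lan.map (H.map α)) f.op _

lemma IsCoveringFlat.preservesFiniteLimits (hF : IsCoveringFlat K F) :
    PreservesFiniteLimits
      ((F.op.lan : (Cᵒᵖ ⥤ Type u) ⥤ (Dᵒᵖ ⥤ Type u)) ⋙ presheafToSheaf K (Type u)) where
  preservesFiniteLimits E _ _ := ⟨fun {H} => ⟨fun {c} hc => by
    have hd := limit.isLimit (H ⋙ F.op.lan)
    have := hF.isLocallyInjective_lift hc hd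
    have := hF.isLocallySurjective_lift hc hd
    have hW : K.W (hd.lift (F.op.lan.mapCone c)) := K.W_of_isLocallyBijective _
    rw [K.W_iff] at hW
    refine ⟨IsLimit.ofIsoLimit (isLimitOfPreserves (presheafToSheaf K (Type u)) hd)
      (Cone.ext (asIso ((presheafToSheaf K (Type u)).map (hd.lift (F.op.lan.mapCone c)))).symm
        fun e => ?_)⟩
    rw [Iso.symm_hom, Iso.eq_inv_comp, asIso_hom]
    refine ((presheafToSheaf K (Type u)).map_comp _ _).symm.trans ?_
    rw [hd.fac]
    rfl⟩⟩

/-- The transformation from the left Kan extension of a representable presheaf to the presheaf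
represented by the image of the representing object. -/
noncomputable def lanYonedaToYoneda (F : C ⥤ D) (x : C) :
    F.op.lan.obj (yoneda.obj x) ⟶ yoneda.obj (F.obj x) :=
  ((F.op.lanAdjunction (Type u)).homEquiv _ _).symm (yonedaMap F x)

/-- This turns equalities of classes into equalities of morphisms of `D`. -/
lemma lanYonedaToYoneda_app_lanMk {v : D} {x y : C} (h : v ⟶ F.obj y) (g : y ⟶ x) :
    (lanYonedaToYoneda F x).app (op v) (lanMk (P := yoneda.obj x) h g) = h ≫ F.map g := by
  have h₁ := ((F.op.lanAdjunction (Type u)).homEquiv _ _).apply_symm_apply (yonedaMap F x)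
  rw [Adjunction.homEquiv_unit, Functor.lanAdjunction_unit] at h₁
  have h₂ := ConcreteCategory.congr_hom (congr_app h₁ (op y)) g
  rw [lanMk]
  refine (NatTrans.naturality_apply (lanYonedaToYoneda F x) h.op _).trans ?_
  exact congrArg (fun k => h ≫ k) h₂

lemma isCoveringFlat_of_preservesFiniteLimits
    (hF : PreservesFiniteLimits
      ((F.op.lan : (Cᵒᵖ ⥤ Type u) ⥤ (Dᵒᵖ ⥤ Type u)) ⋙ presheafToSheaf K (Type u))) :
    IsCoveringFlat K F := by
  rw [isCoveringFlat_iff_coneSieve_mem]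
  intro E _ _ G T
  have hc := limit.isLimit (G ⋙ yoneda)
  have hd := limit.isLimit ((G ⋙ yoneda) ⋙ F.op.lan)
  let a := presheafToSheaf K (Type u)
  let φ := hd.lift (F.op.lan.mapCone (limit.cone (G ⋙ yoneda)))
  have hW : K.W φ := by
    rw [K.W_iff]
    have h₁ := isLimitOfPreserves (F.op.lan ⋙ a) hc
    have h₂ := isLimitOfPreserves a hd
    have : a.map φ = (h₁.conePointUniqueUpToIso h₂).hom := h₂.hom_ext fun e => by
      refine Eq.trans ?_ (h₁.conePointUniqueUpToIso_hom_comp h₂ e).symm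
      refine (a.map_comp _ _).symm.trans ?_
      rw [hd.fac]
      rfl
    rw [this]
    infer_instance
  have := hW.isLocallySurjective
  -- `s` is the cone `T`, seen as an element of the limit.
  obtain ⟨s, hs⟩ := isLimit_presheaf_exists hd (U := op T.pt)
    (fun e => lanMk (P := yoneda.obj (G.obj e)) (T.π.app e) (𝟙 (G.obj e))) (fun e e' α => by
      refine (lan_map_app_lanMk _ _ _).trans ?_
      have h₁ := T.w α
      rw [← h₁]
      refine Eq.trans ?_ (lanMk_comp_map _ _ _).symm
      congr 1
      simp)
  refine K.superset_covering ?_ (Presheaf.imageSieve_mem K φ s)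
  rintro w f ⟨t, ht⟩
  obtain ⟨x, h, ℓ, rfl⟩ := exists_lanMk_eq t
  refine ⟨⟨x, 
    { app := fun e => ((limit.cone (G ⋙ yoneda)).π.app e).app (op x) ℓ
      naturality := fun e e' α => ?_ }⟩, h, fun e => ?_⟩
  · have h₁ := ConcreteCategory.congr_hom (congr_app ((limit.cone (G ⋙ yoneda)).w α) (op x)) ℓ
    refine (Category.id_comp _).trans h₁.symm
  · have h₁ := congrArg (((limit.cone ((G ⋙ yoneda) ⋙ F.op.lan)).π.app e).app (op w)) ht
    have h₂ := congrArg ((lanYonedaToYoneda F (G.obj e)).app (op w)) h₁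
    rw [isLimit_lift_lan_app_lanMk, cone_π_app_map_apply, hs] at h₂
    have h₃ := lan_obj_map_lanMk (P := yoneda.obj (G.obj e)) f (T.π.app e) (𝟙 (G.obj e))
    have h₄ := h₂.trans (congrArg ((lanYonedaToYoneda F (G.obj e)).app (op w)) h₃)
    refine Eq.trans ?_ (h₄.symm.trans (lanYonedaToYoneda_app_lanMk _ _))
    refine Eq.trans ?_ (lanYonedaToYoneda_app_lanMk _ _).symm
    simp

end FiniteLimits

/-! ### The geometric morphism of a morphism of sites. -/

section Morphisms

variable {C : Type u} [SmallCategory.{u} C] {D : Type u} [SmallCategory.{u} D]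
  {J : GrothendieckTopology C} {K : GrothendieckTopology D} {F : C ⥤ D}

/-- The given square in `D` locally comes from a commutative square in `C`, where compatibility
applies; separatedness of `P` concludes. -/
lemma IsCoveringFlat.compatiblePreserving (hF : IsCoveringFlat K F) :
    CompatiblePreserving.{u} K F where
  compatible P Z T x hx Y₁ Y₂ X f₁ f₂ g₁ g₂ hg₁ hg₂ e := by
    obtain ⟨R, hR, H⟩ := hF.exists_commSq f₁ f₂ g₁ g₂ e
    refine (((isSheaf_iff_isSheaf_of_type _ _).1 P.2).isSeparated _ hR).ext ?_
    intro w f hf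
    obtain ⟨z, k, a, b, ha, hb, hab⟩ := H f hf
    have h₁ := congrArg (P.obj.map k.op) (hx a b hg₁ hg₂ hab)
    rw [← Functor.map_comp_apply, ← Functor.map_comp_apply, ← op_comp, ← op_comp, ha, hb,
      op_comp, op_comp, Functor.map_comp_apply, Functor.map_comp_apply]
    exact h₁

lemma IsMorphismOfSites.coverPreserving (hF : IsMorphismOfSites J K F) :
    CoverPreserving J K F where
  cover_preserve {U S} hS := by
    obtain ⟨ι, V, f, rfl⟩ := S.exists_eq_ofArrows
    refine K.superset_covering ?_ (hF.map_isCoveringFamily V f hS)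
    rw [Sieve.ofArrows, Sieve.generate_le_iff]
    rintro _ _ ⟨i⟩
    have hi : Sieve.ofArrows V f (f i) := Sieve.ofArrows_mk V f i
    exact Sieve.image_mem_functorPushforward F _ hi

lemma IsMorphismOfSites.isContinuous (hF : IsMorphismOfSites J K F) :
    Functor.IsContinuous.{u} F J K :=
  Functor.isContinuous_of_coverPreserving hF.isCoveringFlat.compatiblePreserving
    hF.coverPreserving

lemma IsMorphismOfSites.isSheaf_op_comp (hF : IsMorphismOfSites J K F) (P : Dᵒᵖ ⥤ Type u)
    (hP : Presheaf.IsSheaf K P) : Presheaf.IsSheaf J (F.op ⋙ P) :=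
  have := hF.isContinuous
  F.op_comp_isSheaf J K ⟨P, hP⟩

/-- The geometric morphism induced by a morphism of sites: its direct image is restriction, and
its inverse image is the sheafification of the left Kan extension. -/
noncomputable def IsMorphismOfSites.geometricMorphism (hF : IsMorphismOfSites J K F) :
    GeometricMorphism (Sheaf K (Type u)) (Sheaf J (Type u)) where
  directImage := restrictSheaves J K F hF.isSheaf_op_comp
  inverseImage := sheafToPresheaf J (Type u) ⋙ F.op.lan ⋙ presheafToSheaf K (Type u)
  adjunction :=
    ((F.op.lanAdjunction (Type u)).comp (sheafificationAdjunction K (Type u))).restrictFullyFaithful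
      (fullyFaithfulSheafToPresheaf J (Type u)) (Functor.FullyFaithful.id _)
      (Iso.refl _) (Iso.refl _)
  preservesFiniteLimits :=
    have := hF.isCoveringFlat.preservesFiniteLimits
    comp_preservesFiniteLimits _ _

end Morphisms

end Sites

theorem mainTheorem11 {C : Type u} [SmallCategory.{u} C] {D : Type u} [SmallCategory.{u} D]
    (K : GrothendieckTopology D) (F : C ⥤ D) :
    (Sites.IsCoveringFlat K F ↔
      PreservesFiniteLimits
        ((F.op.lan : (Cᵒᵖ ⥤ Type u) ⥤ (Dᵒᵖ ⥤ Type u)) ⋙ presheafToSheaf K (Type u))) ∧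
    ∀ J : GrothendieckTopology C, Sites.IsMorphismOfSites J K F →
      ∃ h : ∀ P : Dᵒᵖ ⥤ Type u, Presheaf.IsSheaf K P → Presheaf.IsSheaf J (F.op ⋙ P),
        ∃ g : Sites.GeometricMorphism (Sheaf K (Type u)) (Sheaf J (Type u)),
          g.directImage = Sites.restrictSheaves J K F h :=
  ⟨⟨fun hF => hF.preservesFiniteLimits, Sites.isCoveringFlat_of_preservesFiniteLimits⟩,
    fun _ hF => ⟨hF.isSheaf_op_comp, hF.geometricMorphism, rfl⟩⟩
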